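/- All rings are commutative with identity. Let $D$ be an integral domain with fraction field $K$, and let $R = D \propto K$ be the trivial ring extension of $D$ by $K$, that is, the additive group $D \times K$ with multiplication $(a,e)(a',e') = (aa', ae' + a'e)$. Then the following statements are equivalent: 1. $D$ is a Prüfer domain, i.e. every nonzero finitely generated ideal of $D$ is invertible; 2. $R$ is an arithmetical ring, i.e. for every finitely generated ideal $I$ of $R$ and every maximal ideal $M$ of $R$, the ideal $I R_M$ is principal; 3. $R$ is a Gaussian ring, i.e. $c(fg) = c(f)c(g)$ for all polynomials $f, g \in R[x]$, where $c(f)$ denotes the ideal of $R$ generated by the coefficients of $f$; 4. $R$ is a Prüfer ring, i.e. every finitely generated ideal of $R$ that contains a non-zero-divisor is invertible. Here an ideal of a ring $A$ is called invertible if it is invertible as a fractional ideal in the total ring of quotients of $A$. -/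

import Mathlib

open scoped nonZeroDivisors

/-- An ideal `I` of a commutative ring `A` is invertible if it is invertible as a fractional ideal
in the total ring of quotients of `A`, the localization of `A` at its non-zero-divisors. -/
def Ideal.IsInvertible {A : Type*} [CommRing A] (I : Ideal A) : Prop :=
  IsUnit (I : FractionalIdeal A⁰ (FractionRing A))

/-- An ideal is regular if it contains a regular element, i.e. a non-zero-divisor. -/
def Ideal.IsRegularIdeal {A : Type*} [CommRing A] (I : Ideal A) : Prop :=
  ∃ x ∈ I, x ∈ A⁰

/-- An ideal is locally principal if its extension to the localization at every maximal ideal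
is principal. -/
def Ideal.IsLocallyPrincipal {A : Type*} [CommRing A] (I : Ideal A) : Prop :=
  ∀ (M : Ideal A) [M.IsMaximal],
    (I.map (algebraMap A (Localization.AtPrime M))).IsPrincipal

/-- A Prüfer domain: an integral domain in which every nonzero finitely generated ideal is
invertible. -/
def IsPruferDomain (A : Type*) [CommRing A] : Prop :=
  IsDomain A ∧ ∀ I : Ideal A, I ≠ ⊥ → I.FG → I.IsInvertible

/-- An arithmetical ring: every finitely generated ideal is locally principal. -/
def IsArithmeticalRing (A : Type*) [CommRing A] : Prop :=
  ∀ I : Ideal A, I.FG → I.IsLocallyPrincipal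

/-- A Gaussian ring: `c(fg) = c(f) c(g)` for all polynomials `f, g`, where the content `c(f)` is
the ideal generated by the coefficients of `f`. -/
def IsGaussianRing (A : Type*) [CommRing A] : Prop :=
  ∀ f g : Polynomial A, (f * g).contentIdeal = f.contentIdeal * g.contentIdeal

/-- A Prüfer ring: every finitely generated regular ideal is invertible. -/
def IsPruferRing (A : Type*) [CommRing A] : Prop :=
  ∀ I : Ideal A, I.FG → I.IsRegularIdeal → I.IsInvertible

/-! The pivot is `LocallyDvdTotal`: after localizing at any prime, one of two given elements divides
the other. For domains this is the Prüfer condition; in any ring it implies arithmetical, hence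
Gaussian. It ascends from `D` to `D ∝ K` because divisibility by an element with nonzero first
component is decided in `D`, while elements of `0 ∝ K` are compared after clearing denominators.
Conversely, the Gaussian property passes to the quotient `D`, where quadratic products give back
`LocallyDvdTotal`. The Prüfer ring condition is compared with `D` directly: regular ideals of `D ∝
K` are extended from `D`. -/

open Polynomial in
/-- The content ideal is the least ideal containing all coefficients. -/
theorem Polynomial.contentIdeal_le {A : Type*} [CommRing A] {f : A[X]} {I : Ideal A}
    (h : ∀ n, f.coeff n ∈ I) : f.contentIdeal ≤ I := by
  rw [contentIdeal_def, Ideal.span_le]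
  intro r hr
  obtain ⟨n, -, rfl⟩ := mem_coeffs_iff.mp hr
  exact h n

open Polynomial in
theorem Polynomial.mem_contentIdeal_of_coeff_eq {A : Type*} [CommRing A] {f : A[X]} {n : ℕ}
    {r : A} (h : f.coeff n = r) : r ∈ f.contentIdeal := by
  subst h
  exact coeff_mem_contentIdeal f n

/-- Invertibility of an ideal, without reference to the total ring of quotients. -/
theorem Ideal.isInvertible_iff {A : Type*} [CommRing A] {I : Ideal A} :
    I.IsInvertible ↔ ∃ (J : Ideal A) (x : A), x ∈ A⁰ ∧ I * J = Ideal.span {x} := by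
  unfold Ideal.IsInvertible
  rw [isUnit_iff_exists_inv]
  constructor
  · rintro ⟨J, hJ⟩
    refine ⟨J.num, J.den, J.den.2, ?_⟩
    apply FractionalIdeal.coeIdeal_injective' (P := FractionRing A) (le_refl A⁰)
    simp only [FractionalIdeal.coeIdeal_mul, FractionalIdeal.coeIdeal_span_singleton]
    rw [← FractionalIdeal.den_mul_self_eq_num', mul_left_comm, hJ, mul_one]
  · rintro ⟨J, x, hx, h⟩
    have hu := IsLocalization.map_units (FractionRing A) (⟨x, hx⟩ : A⁰)
    obtain ⟨u, hu⟩ := hu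
    refine ⟨J * FractionalIdeal.spanSingleton A⁰ (↑u⁻¹ : FractionRing A), ?_⟩
    rw [← mul_assoc, ← FractionalIdeal.coeIdeal_mul, h, FractionalIdeal.coeIdeal_span_singleton,
      FractionalIdeal.spanSingleton_mul_spanSingleton]
    simp only at hu
    rw [← hu, Units.mul_inv, FractionalIdeal.spanSingleton_one]

/-! ### Locally total divisibility and Prüfer domains -/

/-- Any two elements divide one another locally: the ideals `(a : b)` and `(b : a)` are
comaximal. -/
def LocallyDvdTotal (A : Type*) [CommRing A] : Prop :=
  ∀ a b : A, ∃ s t : A, s + t = 1 ∧ a ∣ s * b ∧ b ∣ t * a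

/-- If divisibility is locally total, every finitely generated ideal is generated by one of its
elements, locally at each prime. -/
theorem LocallyDvdTotal.exists_dvd {A : Type*} [CommRing A] (hA : LocallyDvdTotal A)
    (P : Ideal A) [P.IsPrime] {I : Ideal A} (hI : I.FG) :
    ∃ a ∈ I, ∃ s ∉ P, ∀ x ∈ I, a ∣ s * x := by
  induction I, hI using Submodule.fg_induction with
  | singleton a =>
    refine ⟨a, Submodule.mem_span_singleton_self a, 1,
      fun h => Ideal.IsPrime.ne_top' ((Ideal.eq_top_iff_one P).mpr h), fun x hx => ?_⟩
    rw [one_mul]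
    exact Ideal.mem_span_singleton.mp hx
  | sup I J _ _ hI hJ =>
    obtain ⟨a, ha, s, hs, hsa⟩ := hI
    obtain ⟨b, hb, t, ht, htb⟩ := hJ
    obtain ⟨u, v, huv, hau, hbv⟩ := hA a b
    have hor : u ∉ P ∨ v ∉ P := by
      by_contra! h
      exact Ideal.IsPrime.ne_top' ((Ideal.eq_top_iff_one P).mpr (huv ▸ P.add_mem h.1 h.2))
    rcases hor with hu | hv
    · refine ⟨a, Submodule.mem_sup_left ha, s * t * u, ?_, fun x hx => ?_⟩
      · simp only [Ideal.IsPrime.mul_mem_iff_mem_or_mem]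
        tauto
      · obtain ⟨y, hy, z, hz, rfl⟩ := Submodule.mem_sup.mp hx
        have h1 : a ∣ t * u * (s * y) := (hsa y hy).mul_left _
        have h2 : a ∣ s * (u * (t * z)) := ((hau.trans (mul_dvd_mul_left u (htb z hz)))).mul_left _
        convert h1.add h2 using 1
        ring
    · refine ⟨b, Submodule.mem_sup_right hb, s * t * v, ?_, fun x hx => ?_⟩
      · simp only [Ideal.IsPrime.mul_mem_iff_mem_or_mem]
        tauto
      · obtain ⟨y, hy, z, hz, rfl⟩ := Submodule.mem_sup.mp hx
        have h1 : b ∣ s * v * (t * z) := (htb z hz).mul_left _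
        have h2 : b ∣ t * (v * (s * y)) := ((hbv.trans (mul_dvd_mul_left v (hsa y hy)))).mul_left _
        convert h1.add h2 using 1
        ring

theorem LocallyDvdTotal.isArithmeticalRing {A : Type*} [CommRing A] (hA : LocallyDvdTotal A) :
    IsArithmeticalRing A := by
  intro I hI M hM
  obtain ⟨a, ha, s, hs, h⟩ := hA.exists_dvd M hI
  refine ⟨algebraMap A _ a, le_antisymm ?_ ?_⟩
  · refine Ideal.map_le_iff_le_comap.mpr fun x hx => ?_
    have hu : IsUnit (algebraMap A (Localization.AtPrime M) s) :=
      IsLocalization.map_units _ (⟨s, hs⟩ : M.primeCompl)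
    refine Ideal.mem_comap.mpr (Ideal.mem_span_singleton.mpr ?_)
    rw [← hu.dvd_mul_left, ← map_mul]
    exact map_dvd _ (h x hx)
  · rw [Submodule.span_singleton_le_iff_mem]
    exact Ideal.mem_map_of_mem _ ha

/-- A domain in which divisibility is locally total is a Prüfer domain. -/
theorem LocallyDvdTotal.isPruferDomain {D : Type*} [CommRing D] [IsDomain D]
    (hD : LocallyDvdTotal D) : IsPruferDomain D := by
  refine ⟨inferInstance, fun I hI0 hI => ?_⟩
  obtain ⟨x, hxI, hx0⟩ := Submodule.exists_mem_ne_zero_of_ne_bot hI0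
  have hmemJ : ∀ t, t ∈ Submodule.colon (Ideal.span {x}) (I : Set D) ↔ ∀ y ∈ I, x ∣ t * y := by
    intro t
    simp [Submodule.mem_colon, Ideal.mem_span_singleton]
  refine Ideal.isInvertible_iff.mpr ⟨Submodule.colon (Ideal.span {x}) (I : Set D), x,
    mem_nonZeroDivisors_of_ne_zero hx0, le_antisymm ?_ ?_⟩
  · rw [Ideal.mul_le]
    intro y hy t ht
    rw [Ideal.mem_span_singleton, mul_comm]
    exact (hmemJ t).mp ht y hy
  · rw [Ideal.span_singleton_le_iff_mem]
    by_contra hx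
    -- With `J = (x) : I`, a local generator `a` of `I` gives `s * x = a * t` with `t ∈ J`, so `s ∈
    -- L` although `s ∉ M`.
    let L : Ideal D := Submodule.colon (I * Submodule.colon (Ideal.span {x}) (I : Set D)) {x}
    have hL : L ≠ ⊤ := by
      intro h
      have h1 : (1 : D) ∈ L := h ▸ Submodule.mem_top
      simp only [L, Submodule.mem_colon_singleton, one_smul] at h1
      exact hx h1
    obtain ⟨M, hM, hLM⟩ := Ideal.exists_le_maximal L hL
    obtain ⟨a, ha, s, hs, h⟩ := hD.exists_dvd M hI
    refine hs (hLM ?_)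
    simp only [L, Submodule.mem_colon_singleton, smul_eq_mul]
    obtain ⟨t, ht⟩ := h x hxI
    rw [ht]
    refine Ideal.mul_mem_mul ha ((hmemJ t).mpr fun y hy => ?_)
    have ha0 : a ≠ 0 := by
      rintro rfl
      rw [zero_mul] at ht
      rcases mul_eq_zero.mp ht with rfl | h
      · exact hs M.zero_mem
      · exact hx0 h
    obtain ⟨c, hc⟩ := h y hy
    refine ⟨c, mul_left_cancel₀ ha0 ?_⟩
    calc a * (t * y) = (s * x) * y := by rw [ht]; ring
      _ = x * (s * y) := by ring
      _ = a * (x * c) := by rw [hc]; ring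

/-- If `(a, b) J = (x)`, write `x = a u + b v`; then `s = a u / x` and `t = b v / x` work. -/
theorem IsPruferDomain.locallyDvdTotal {D : Type*} [CommRing D] (hD : IsPruferDomain D) :
    LocallyDvdTotal D := by
  obtain ⟨_, hD⟩ := hD
  intro a b
  by_cases h0 : Ideal.span {a, b} = ⊥
  · have ha : a = 0 := by
      have : a ∈ Ideal.span {a, b} := Ideal.subset_span (by simp)
      simpa [h0] using this
    exact ⟨0, 1, by simp, by simp, by simp [ha]⟩
  · obtain ⟨J, x, hx, h⟩ := Ideal.isInvertible_iff.mp
      (hD _ h0 (Submodule.fg_span (Set.toFinite _)))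
    have hx0 := nonZeroDivisors.ne_zero hx
    have hdvd : ∀ y ∈ Ideal.span {a, b}, ∀ u ∈ J, x ∣ y * u := fun y hy u hu =>
      Ideal.mem_span_singleton.mp (h ▸ Ideal.mul_mem_mul hy hu)
    have hxm : x ∈ Ideal.span {a, b} * J := h ▸ Ideal.mem_span_singleton_self x
    rw [Ideal.span_insert, Ideal.sup_mul, Submodule.mem_sup] at hxm
    obtain ⟨y, hy, z, hz, hyz⟩ := hxm
    obtain ⟨u, hu, rfl⟩ := Ideal.mem_span_singleton_mul.mp hy
    obtain ⟨v, hv, rfl⟩ := Ideal.mem_span_singleton_mul.mp hz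
    have ha : a ∈ Ideal.span {a, b} := Ideal.subset_span (by simp)
    have hb : b ∈ Ideal.span {a, b} := Ideal.subset_span (by simp)
    obtain ⟨s, hs⟩ := hdvd a ha u hu
    obtain ⟨t, ht⟩ := hdvd b hb v hv
    obtain ⟨c, hc⟩ := hdvd b hb u hu
    obtain ⟨d, hd⟩ := hdvd a ha v hv
    refine ⟨s, t, mul_left_cancel₀ hx0 ?_, ⟨c, mul_left_cancel₀ hx0 ?_⟩,
      ⟨d, mul_left_cancel₀ hx0 ?_⟩⟩
    · rw [mul_add, ← hs, ← ht, hyz, mul_one]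
    · linear_combination (-b) * hs + a * hc
    · linear_combination (-a) * ht + b * hd

/-! ### Arithmetical and Gaussian rings -/

open Polynomial in
/-- Over a local ring, a polynomial with principal content ideal is a multiple of one with
unit content. -/
theorem IsLocalRing.exists_eq_C_mul_of_contentIdeal_isPrincipal {A : Type*} [CommRing A]
    [IsLocalRing A] {f : A[X]} (hf : f.contentIdeal.IsPrincipal) :
    ∃ (a : A) (p : A[X]), f = C a * p ∧ p.contentIdeal = ⊤ := by
  obtain ⟨p, hp⟩ := hf.contentIdeal_generator_dvd
  set a := hf.generator with ha
  by_cases hpt : p.contentIdeal = ⊤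
  · exact ⟨a, p, hp, hpt⟩
  · refine ⟨0, 1, ?_, contentIdeal_one⟩
    have hmem : a ∈ Ideal.span {a} * p.contentIdeal := by
      have h1 := contentIdeal_mul_le_mul_contentIdeal (C a) p
      rw [← hp, contentIdeal_C] at h1
      exact h1 (Submodule.IsPrincipal.generator_mem _)
    obtain ⟨z, hz, hza⟩ := Ideal.mem_span_singleton_mul.mp hmem
    have hzm := IsLocalRing.le_maximalIdeal hpt hz
    have hu : IsUnit (1 - z) :=
      IsLocalRing.isUnit_one_sub_self_of_mem_nonunits z ((IsLocalRing.mem_maximalIdeal z).mp hzm)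
    have ha0 : a = 0 := by
      rw [← hu.mul_left_eq_zero]
      linear_combination -hza
    rw [hp, ha0, C_0, zero_mul, zero_mul]

open Polynomial in
theorem Polynomial.contentIdeal_C_mul {A : Type*} [CommRing A] (a : A) (p : A[X]) :
    (C a * p).contentIdeal = Ideal.span {a} * p.contentIdeal := by
  refine le_antisymm ?_ ?_
  · simpa using contentIdeal_mul_le_mul_contentIdeal (C a) p
  · rw [contentIdeal_def p, Ideal.span_mul_span', Ideal.span_le]
    rintro _ ⟨b, rfl, r, hr, rfl⟩
    obtain ⟨n, -, rfl⟩ := mem_coeffs_iff.mp hr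
    simpa using! coeff_mem_contentIdeal (C b * p) n

-- Locally each factor is a constant times a polynomial of unit content, and unit contents are
-- stable under products.
open Polynomial in
theorem IsArithmeticalRing.isGaussianRing {A : Type*} [CommRing A] (hA : IsArithmeticalRing A) :
    IsGaussianRing A := by
  intro f g
  refine Ideal.eq_of_localization_maximal fun M hM => ?_
  have hf := hA _ f.contentIdeal_FG M
  have hg := hA _ g.contentIdeal_FG M
  rw [Ideal.map_mul]
  simp only [← contentIdeal_map_eq_map_contentIdeal, Polynomial.map_mul] at hf hg ⊢
  obtain ⟨a, p, hfp, hp⟩ := IsLocalRing.exists_eq_C_mul_of_contentIdeal_isPrincipal hf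
  obtain ⟨b, q, hgq, hq⟩ := IsLocalRing.exists_eq_C_mul_of_contentIdeal_isPrincipal hg
  rw [hfp, hgq, mul_mul_mul_comm, ← C_mul]
  simp only [contentIdeal_C_mul, contentIdeal_mul_eq_top_of_contentIdeal_eq_top hp hq, hp, hq,
    Ideal.mul_top, Ideal.span_singleton_mul_span_singleton]

open Polynomial in
theorem IsGaussianRing.of_surjective {A B : Type*} [CommRing A] [CommRing B] (φ : A →+* B)
    (hφ : Function.Surjective φ) (hA : IsGaussianRing A) : IsGaussianRing B := by
  intro f g
  obtain ⟨f, rfl⟩ := map_surjective φ hφ f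
  obtain ⟨g, rfl⟩ := map_surjective φ hφ g
  rw [← Polynomial.map_mul]
  simp only [contentIdeal_map_eq_map_contentIdeal, hA f g, Ideal.map_mul]

open Polynomial in
theorem IsGaussianRing.locallyDvdTotal {D : Type*} [CommRing D] [IsDomain D]
    (hD : IsGaussianRing D) : LocallyDvdTotal D := by
  have key : ∀ (a b c d : D) (I : Ideal D), a * c ∈ I → a * d + b * c ∈ I → b * d ∈ I →
      b * c ∈ I := by
    intro a b c d I h2 h1 h0
    have hle : ((C a * X + C b) * (C c * X + C d)).contentIdeal ≤ I := by
      refine contentIdeal_le fun n => ?_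
      have hmul : (C a * X + C b) * (C c * X + C d) =
          C (a * c) * X ^ 2 + C (a * d + b * c) * X + C (b * d) := by
        simp only [C_mul, C_add]; ring
      rw [hmul, coeff_add, coeff_add, coeff_C_mul, coeff_C_mul]
      match n with
      | 0 => simpa using h0
      | 1 => simpa [coeff_X_pow, coeff_C] using h1
      | 2 => simpa [coeff_X, coeff_C] using h2
      | n + 3 => simp [coeff_X_pow, coeff_X]
    rw [hD] at hle
    refine hle (Ideal.mul_mem_mul ?_ ?_)
    · exact mem_contentIdeal_of_coeff_eq (n := 0) (by simp)
    · exact mem_contentIdeal_of_coeff_eq (n := 1) (by simp [coeff_C])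
  intro a b
  by_cases ha : a = 0
  · exact ⟨0, 1, by simp, by simp, by simp [ha]⟩
  -- From `(aX + b)(aX - b)`: `a b = r a² + s b²`.
  have hab := key a b a (-b) (Ideal.span {a * a, b * b})
    (Ideal.subset_span (by simp)) (by convert Ideal.zero_mem _ using 1; ring)
    (by rw [mul_neg, neg_mem_iff]; exact Ideal.subset_span (by simp))
  obtain ⟨r, s, hrs⟩ := Ideal.mem_span_pair.mp hab
  -- From `(aX - s b)(aX + s b - a)`: all coefficients lie in `(a²)`, hence so does `s a b`, and `a
  -- ∣ s b`.
  have hsb := key a (-(s * b)) a (s * b - a) (Ideal.span {a * a})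
    (Ideal.mem_span_singleton_self _)
    (Ideal.mem_span_singleton.mpr ⟨-1, by ring⟩)
    (Ideal.mem_span_singleton.mpr ⟨s * r, by linear_combination (-s) * hrs⟩)
  obtain ⟨w, hw⟩ := Ideal.mem_span_singleton.mp hsb
  have hw' : s * b = -w * a := mul_right_cancel₀ ha (by linear_combination -hw)
  refine ⟨1 + w, -w, by ring, ⟨r, mul_left_cancel₀ ha ?_⟩, ⟨s, ?_⟩⟩
  · linear_combination b * hw' - hrs
  · linear_combination -hw'

/-! ### The trivial extension -/

namespace TrivSqZeroExt

section

variable {D K : Type*} [CommRing D] [Field K] [Algebra D K] [Module Dᵐᵒᵖ K]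
  [IsCentralScalar D K]

/-- The second component of the quotient is found by dividing by `x.fst` in `K`. -/
theorem dvd_of_fst_dvd [FaithfulSMul D K] {x y : TrivSqZeroExt D K} (hx : x.fst ≠ 0)
    (h : x.fst ∣ y.fst) : x ∣ y := by
  obtain ⟨c, hc⟩ := h
  have hx' : algebraMap D K x.fst ≠ 0 :=
    (map_ne_zero_iff _ (FaithfulSMul.algebraMap_injective D K)).mpr hx
  refine ⟨inl c + inr ((y.snd - c • x.snd) / algebraMap D K x.fst), ext ?_ ?_⟩
  · simpa using hc
  · simp only [snd_mul, snd_add, fst_add, snd_inl, snd_inr, fst_inl, fst_inr, op_smul_eq_smul,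
      Algebra.smul_def]
    field_simp
    simp [mul_comm x.snd]

theorem fst_ne_zero_of_mem_nonZeroDivisors {x : TrivSqZeroExt D K}
    (hx : x ∈ (TrivSqZeroExt D K)⁰) : x.fst ≠ 0 := by
  intro h
  have h1 : (inr 1 : TrivSqZeroExt D K) * x = 0 := by
    ext <;> simp [h]
  have h2 := congrArg snd ((mem_nonZeroDivisors_iff_right.mp hx) _ h1)
  simp at h2

theorem mem_nonZeroDivisors_of_fst_ne_zero [IsDomain D] [FaithfulSMul D K]
    {x : TrivSqZeroExt D K} (hx : x.fst ≠ 0) : x ∈ (TrivSqZeroExt D K)⁰ := by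
  have hx' : algebraMap D K x.fst ≠ 0 :=
    (map_ne_zero_iff _ (FaithfulSMul.algebraMap_injective D K)).mpr hx
  rw [mem_nonZeroDivisors_iff_right]
  intro y hy
  have h1 : y.fst = 0 := by simpa [hx] using congrArg fst hy
  refine ext h1 ?_
  simpa [h1, Algebra.smul_def, hx', -FaithfulSMul.algebraMap_eq_zero_iff] using congrArg snd hy

/-- An element with nonzero first component divides all of `0 ∝ K`, so the ideal contains `0 ∝ K`
and is determined by its image in `D`. -/
theorem map_inlHom_map_fstHom [FaithfulSMul D K] {I : Ideal (TrivSqZeroExt D K)}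
    (hI : ∃ x ∈ I, x.fst ≠ 0) :
    (I.map (fstHom D D K)).map (inlHom D K) = I := by
  obtain ⟨x, hxI, hx⟩ := hI
  have hmem : ∀ y z : TrivSqZeroExt D K, y ∈ I → z.fst = y.fst → z ∈ I := by
    intro y z hy hz
    have : z - y ∈ I := I.mem_of_dvd (dvd_of_fst_dvd hx (by simp [hz])) hxI
    simpa using I.add_mem this hy
  refine le_antisymm ?_ fun y hy => ?_
  · rw [Ideal.map_le_iff_le_comap, Ideal.map_le_iff_le_comap]
    intro y hy
    exact hmem y _ hy (by simp)
  · have hinl : ∀ z ∈ I, inl z.fst ∈ (I.map (fstHom D D K)).map (inlHom D K) := fun z hz =>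
      Ideal.mem_map_of_mem (inlHom D K) (Ideal.mem_map_of_mem (fstHom D D K) hz)
    have : y - inl y.fst ∈ (I.map (fstHom D D K)).map (inlHom D K) :=
      Ideal.mem_of_dvd _ (dvd_of_fst_dvd (by simpa using hx) (by simp)) (hinl x hxI)
    simpa using Ideal.add_mem _ this (hinl y hy)

theorem isPruferRing_of_isPruferDomain [FaithfulSMul D K] (hD : IsPruferDomain D) :
    IsPruferRing (TrivSqZeroExt D K) := by
  obtain ⟨_, hD⟩ := hD
  rintro I hI ⟨x, hxI, hx⟩
  have hx0 := fst_ne_zero_of_mem_nonZeroDivisors hx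
  have hne : I.map (fstHom D D K) ≠ ⊥ := by
    refine (Submodule.ne_bot_iff _).mpr ⟨x.fst, Ideal.mem_map_of_mem (fstHom D D K) hxI, hx0⟩
  obtain ⟨J, d, hd, h⟩ := Ideal.isInvertible_iff.mp (hD _ hne (hI.map _))
  refine Ideal.isInvertible_iff.mpr ⟨J.map (inlHom D K), inl d,
    mem_nonZeroDivisors_of_fst_ne_zero (by simpa using nonZeroDivisors.ne_zero hd), ?_⟩
  rw [← map_inlHom_map_fstHom ⟨x, hxI, hx0⟩, ← Ideal.map_mul, h, Ideal.map_span]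
  simp

theorem isPruferDomain_of_isPruferRing [IsDomain D] [FaithfulSMul D K]
    (hR : IsPruferRing (TrivSqZeroExt D K)) : IsPruferDomain D := by
  refine ⟨inferInstance, fun I hI0 hI => ?_⟩
  obtain ⟨a, haI, ha⟩ := Submodule.exists_mem_ne_zero_of_ne_bot hI0
  obtain ⟨J, x, hx, h⟩ := Ideal.isInvertible_iff.mp (hR (I.map (inlHom D K)) (hI.map _)
    ⟨inl a, Ideal.mem_map_of_mem (inlHom D K) haI,
      mem_nonZeroDivisors_of_fst_ne_zero (by simpa using ha)⟩)
  refine Ideal.isInvertible_iff.mpr ⟨J.map (fstHom D D K).toRingHom, x.fst,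
    mem_nonZeroDivisors_of_ne_zero (fst_ne_zero_of_mem_nonZeroDivisors hx), ?_⟩
  have h' := congrArg (Ideal.map (fstHom D D K).toRingHom) h
  rw [Ideal.map_mul, Ideal.map_map, Ideal.map_span] at h'
  have hid : (fstHom D D K).toRingHom.comp (inlHom D K) = RingHom.id D := RingHom.ext fun _ => rfl
  rw [hid, Ideal.map_id] at h'
  simpa using h'

theorem locallyDvdTotal [IsDomain D] [IsFractionRing D K] (hD : LocallyDvdTotal D) :
    LocallyDvdTotal (TrivSqZeroExt D K) := by
  have : FaithfulSMul D K := (faithfulSMul_iff_algebraMap_injective D K).mpr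
    (IsFractionRing.injective D K)
  intro x y
  by_cases hx : x.fst = 0
  · by_cases hy : y.fst = 0
    · obtain ⟨a, m, hm, hxa⟩ := IsFractionRing.div_surjective (A := D) x.snd
      obtain ⟨b, n, hn, hyb⟩ := IsFractionRing.div_surjective (A := D) y.snd
      have hm' : algebraMap D K m ≠ 0 := IsFractionRing.to_map_ne_zero_of_mem_nonZeroDivisors hm
      have hn' : algebraMap D K n ≠ 0 := IsFractionRing.to_map_ne_zero_of_mem_nonZeroDivisors hn
      -- Over the common denominator `m n`, the second components have numerators `a n` and `b m`.
      obtain ⟨s, t, hst, ⟨c, hc⟩, ⟨d, hd⟩⟩ := hD (a * n) (b * m)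
      have hc' := congrArg (algebraMap D K) hc
      have hd' := congrArg (algebraMap D K) hd
      simp only [map_mul] at hc' hd'
      refine ⟨inl s, inl t, by rw [← inl_add, hst, inl_one],
        ⟨inl c, ext (by simp [hx, hy]) ?_⟩, ⟨inl d, ext (by simp [hx, hy]) ?_⟩⟩
      · simp only [snd_mul, fst_inl, snd_inl, op_smul_eq_smul, Algebra.smul_def, hx, ← hxa, ← hyb,
          smul_zero, add_zero]
        field_simp
        linear_combination hc'
      · simp only [snd_mul, fst_inl, snd_inl, op_smul_eq_smul, Algebra.smul_def, hy, ← hxa, ← hyb,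
          smul_zero, add_zero]
        field_simp
        linear_combination hd'
    · exact ⟨0, 1, by simp, by simp, dvd_of_fst_dvd hy (by simp [hx])⟩
  · by_cases hy : y.fst = 0
    · exact ⟨1, 0, by simp, dvd_of_fst_dvd hx (by simp [hy]), by simp⟩
    · obtain ⟨s, t, hst, hs, ht⟩ := hD x.fst y.fst
      exact ⟨inl s, inl t, by rw [← inl_add, hst, inl_one],
        dvd_of_fst_dvd hx (by simpa using hs), dvd_of_fst_dvd hy (by simpa using ht)⟩

end

end TrivSqZeroExt

/- `TrivSqZeroExt D K` is the trivial ring extension of `D` by `K`. Mathlib builds it from a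
bimodule; the right action is required by `IsCentralScalar` to be the given left one, so it is
determined by the algebra structure and carries no extra data. -/
theorem corollary2p3 (D K : Type*) [CommRing D] [IsDomain D] [Field K] [Algebra D K]
    [IsFractionRing D K] [Module Dᵐᵒᵖ K] [IsCentralScalar D K] :
    List.TFAE [
      IsPruferDomain D,
      IsArithmeticalRing (TrivSqZeroExt D K),
      IsGaussianRing (TrivSqZeroExt D K),
      IsPruferRing (TrivSqZeroExt D K)] := by
  have : FaithfulSMul D K := (faithfulSMul_iff_algebraMap_injective D K).mpr
    (IsFractionRing.injective D K)
  tfae_have 1 → 2 := fun h => (TrivSqZeroExt.locallyDvdTotal h.locallyDvdTotal).isArithmeticalRing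
  tfae_have 2 → 3 := fun h => h.isGaussianRing
  tfae_have 3 → 1 := fun h =>
    (h.of_surjective (TrivSqZeroExt.fstHom D D K).toRingHom
      TrivSqZeroExt.fst_surjective).locallyDvdTotal.isPruferDomain
  tfae_have 1 → 4 := TrivSqZeroExt.isPruferRing_of_isPruferDomain
  tfae_have 4 → 1 := TrivSqZeroExt.isPruferDomain_of_isPruferRing
  tfae_finish
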